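/- Notation. A deterministic logspace transducer is a deterministic Turing machine with finitely many states and tape letters, a read-only input tape (with end markers, head moving in both directions), a read-write work tape of which at most $O(\log n)$ squares are used on every input of length $n\ge 2$ (and $O(1)$ squares for $n\le 1$), and a write-only output tape on which each transition prints, from left to right, at most a fixed number of letters. For finite alphabets $X,Y$, a function $f:X^*\to Y^*$ is logspace computable if some deterministic logspace transducer halts on every input $w\in X^*$ with output $f(w)$. Let $G$ be a group with finite symmetric generating set $X$. A normal form for $(G,X)$ is a set $L\subseteq X^*$ that the evaluation map $w\mapsto\overline{w}$ maps bijectively onto $G$. We say that $(G,X)$ has a logspace normal form if there are a normal form $L$ for $(G,X)$ and a logspace computable function $f:X^*\to X^*$ such that, for all $w\in X^*$, $f(w)$ is the word in $L$ with $\overline{f(w)}=\overline{w}$. We say that $G$ has a logspace normal form if $(G,X)$ does for some finite symmetric generating set $X$ of $G$. Proposition. Let $H$ be a finitely generated group and let $G$ be a subgroup of finite index in $H$. Then $H$ has a logspace normal form if and only if $G$ has a logspace normal form. Moreover, this does not depend on generating sets: for all finite symmetric generating sets $Y$ of $H$ and $X$ of $G$, $(H,Y)$ has a logspace normal form if and only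 if $(G,X)$ has a logspace normal form. -/

import Mathlib

namespace LogspaceNF

/-! ## Deterministic logspace transducers -/

/-- Contents of a square of the input tape: a letter, or one of the two end markers. -/
inductive InSym (α : Type*) where
  | leftEnd : InSym α
  | letter : α → InSym α
  | rightEnd : InSym α

/-- Moves of a tape head. -/
inductive Move where
  | left : Move
  | stay : Move
  | right : Move

/-- What a transition does: change the state, write a letter on the scanned square of the work
tape, move the input head and the work head, and print a finite string on the output tape. -/
structure Action (β Q Γ : Type*) where
  next : Q
  write : Γ
  inMove : Move
  workMove : Move
  emit : List β

/-- A deterministic transducer with input alphabet `α`, output alphabet `β`, states `Q` and work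
alphabet `Γ`. A transition depends on the state, the scanned square of the input tape and the
scanned square of the work tape; the value `none` means that the machine halts. -/
structure Transducer (α β Q Γ : Type*) where
  start : Q
  blank : Γ
  trans : Q → InSym α → Γ → Option (Action β Q Γ)

/-- A configuration. The work tape has squares `0, 1, 2, …`; `out` is what has been printed. -/
structure Cfg (β Q Γ : Type*) where
  state : Q
  inPos : ℕ
  work : ℕ → Γ
  workPos : ℕ
  out : List β

/-- Square `p` of the input tape holding `w`: the left end marker is in square `0`, the letters of
`w` are in squares `1, …, |w|`, and the right end marker is in square `|w| + 1`. -/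
def inputAt {α : Type*} (w : List α) : ℕ → InSym α
  | 0 => InSym.leftEnd
  | p + 1 =>
    match w[p]? with
    | some a => InSym.letter a
    | none => InSym.rightEnd

/-- The input head stays between the end markers (inclusive) of an input of length `n`. -/
def moveInput (n : ℕ) : Move → ℕ → ℕ
  | Move.left, p => p - 1
  | Move.stay, p => p
  | Move.right, p => min (p + 1) (n + 1)

/-- The work tape is infinite to the right; moving left from square `0` has no effect. -/
def moveWork : Move → ℕ → ℕ
  | Move.left, p => p - 1
  | Move.stay, p => p
  | Move.right, p => p + 1

namespace Transducer

variable {α β Q Γ : Type*}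

/-- The initial configuration: the input head is on the first square after the left end marker,
the work tape is blank, and nothing has been printed. -/
def init (M : Transducer α β Q Γ) : Cfg β Q Γ where
  state := M.start
  inPos := 1
  work := fun _ => M.blank
  workPos := 0
  out := []

/-- The configuration that results from `C` by an action, on an input of length `n`. -/
def perform (n : ℕ) (C : Cfg β Q Γ) (A : Action β Q Γ) : Cfg β Q Γ where
  state := A.next
  inPos := moveInput n A.inMove C.inPos
  work := Function.update C.work C.workPos A.write
  workPos := moveWork A.workMove C.workPos
  out := C.out ++ A.emit

/-- One step of the machine on input `w`; `none` if the machine has halted. -/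
def step (M : Transducer α β Q Γ) (w : List α) (C : Cfg β Q Γ) : Option (Cfg β Q Γ) :=
  (M.trans C.state (inputAt w C.inPos) (C.work C.workPos)).map (perform w.length C)

/-- On input `w` the machine halts with `v` on its output tape. -/
def Outputs (M : Transducer α β Q Γ) (w : List α) (v : List β) : Prop :=
  ∃ C : Cfg β Q Γ, StateTransition.Reaches (M.step w) M.init C ∧ M.step w C = none ∧ C.out = v

/-- On input `w` the machine uses at most the squares `0, …, s - 1` of its work tape. -/
def RunsInSpace (M : Transducer α β Q Γ) (w : List α) (s : ℕ) : Prop :=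
  ∀ C : Cfg β Q Γ, StateTransition.Reaches (M.step w) M.init C → C.workPos < s

end Transducer

/-- `f` is computed by a deterministic transducer with finitely many states and finitely many work
letters that uses at most `c (⌊log₂ n⌋ + 1)` work squares on every input of length `n`. (The
summand `1` only matters for `n ≤ 1`. As the transition table is finite, the number of letters
printed in one step is bounded.) -/
def LogspaceComputable {α β : Type*} [Finite α] [Finite β] (f : List α → List β) : Prop :=
  ∃ (Q Γ : Type) (_ : Finite Q) (_ : Finite Γ) (M : Transducer α β Q Γ) (c : ℕ),
    ∀ w : List α, M.Outputs w (f w) ∧ M.RunsInSpace w (c * (Nat.log 2 w.length + 1))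

/-! ## Normal forms of groups -/

section Groups

variable {G : Type*} [Group G]

/-- `X` is a finite symmetric generating set of `G`. -/
def IsSymmGenSet (X : Finset G) : Prop :=
  (∀ x ∈ X, x⁻¹ ∈ X) ∧ Subgroup.closure (X : Set G) = ⊤

/-- The group element represented by a word over `X`. -/
def wordValue (X : Finset G) (w : List X) : G :=
  (w.map Subtype.val).prod

/-- A normal form: a set of words over `X` that is mapped bijectively onto the group. -/
def IsNormalForm (X : Finset G) (L : Set (List X)) : Prop :=
  Set.BijOn (wordValue X) L Set.univ

/-- A logspace normal form function for `(G, X)`: a logspace computable `f` such that, for some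
normal form `L`, `f w` is the word in `L` that represents the same element as `w`. -/
def IsLogspaceNormalFormFunction (X : Finset G) (f : List X → List X) : Prop :=
  LogspaceComputable f ∧
    ∃ L : Set (List X), IsNormalForm X L ∧
      ∀ w : List X, f w ∈ L ∧ wordValue X (f w) = wordValue X w

/-- `(G, X)` has a logspace normal form. -/
def PairHasLogspaceNormalForm (X : Finset G) : Prop :=
  ∃ f : List X → List X, IsLogspaceNormalFormFunction X f

end Groups

/-- The group `G` has a logspace normal form (with respect to some finite symmetric generating
set). -/
def HasLogspaceNormalForm (G : Type*) [Group G] : Prop :=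
  ∃ X : Finset G, IsSymmGenSet X ∧ PairHasLogspaceNormalForm X

end LogspaceNF

/-!
Both implications turn a normal form function for one group into one for the other by rewriting
words with finite automata.

Let `G` have finite index in `H`, and let `t c` represent the right coset `c` of `G` in `H`, with
`t G = 1`. Reading a word over generators of `H` while keeping track of the coset `c` of the prefix,
one can replace each letter `y` by a word for `t c * y * (t (c y))⁻¹`, an element of `G`. This
rewrites a word for `h` as a word for `h * (t (G h))⁻¹` in the generators of `G`
(`exists_transversal`, `SeqAut.prod_out`).

* From `H` to `G`: translate a word over the generators of `G` into generators of `H`, apply the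
  normal form function of `H`, and rewrite the result over the generators of `G`
  (`PairHasLogspaceNormalForm.subgroup`).
* From `G` to `H`: rewrite a word `w` over the generators of `G`, apply the normal form function of
  `G`, translate the result into generators of `H`, and append a word for `t (G w)`
  (`PairHasLogspaceNormalForm.of_subgroup`).

In both cases the result depends only on the element represented by the input, hence the image is
a normal form.

It remains to see that these functions are logspace computable (`LogspaceComputable.comp_seqAut`).
The theorem that logspace computable functions compose is not needed, because the automaton that
rewrites the input is *reversible*: its state before a letter is determined by the letter and the
state after it. A machine for `f` can therefore be run on the rewritten input by a machine whose
head moves in both directions over the original input while the current state of the automaton, and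
the position in the block printed for the current letter, are kept in its finite control. All blocks
are arranged to be nonempty, so that one step is simulated by one step, with the same work tape.
The rewriting of the output also takes place in the finite control. The word to be appended depends
only on the last state of the automaton, which is found by a final scan to the right end marker.
-/

namespace LogspaceNF

universe u

/-! ### Sequential automata -/

/-- A finite-state device that reads a word from left to right and, at each letter, changes its
state and prints a word. -/
structure SeqAut (α β S : Type*) where
  next : S → α → S
  emit : S → α → List β

namespace SeqAut

variable {α β S : Type*} (A : SeqAut α β S)

/-- The state reached from `s` by reading `w`. -/
def state (s : S) (w : List α) : S := w.foldl A.next s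

/-- The word printed while reading `w` from the state `s`. -/
def out : S → List α → List β
  | _, [] => []
  | s, a :: w => A.emit s a ++ out (A.next s a) w

@[simp] lemma state_nil (s : S) : A.state s [] = s := rfl

@[simp] lemma state_cons (s : S) (a : α) (w : List α) :
    A.state s (a :: w) = A.state (A.next s a) w := rfl

@[simp] lemma out_nil (s : S) : A.out s [] = [] := rfl

@[simp] lemma out_cons (s : S) (a : α) (w : List α) :
    A.out s (a :: w) = A.emit s a ++ A.out (A.next s a) w := rfl

@[simp] lemma state_append (s : S) (u v : List α) :
    A.state s (u ++ v) = A.state (A.state s u) v := by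
  simp [state]

@[simp] lemma out_append (s : S) (u v : List α) :
    A.out s (u ++ v) = A.out s u ++ A.out (A.state s u) v := by
  induction u generalizing s with
  | nil => rfl
  | cons a u ih => simp [ih]

lemma length_out_le {K : ℕ} (hK : ∀ s a, (A.emit s a).length ≤ K) (s : S) (w : List α) :
    (A.out s w).length ≤ K * w.length := by
  induction w generalizing s with
  | nil => simp
  | cons a w ih =>
    have h₁ := hK s a
    have h₂ := ih (A.next s a)
    simp only [out_cons, List.length_append, List.length_cons]
    linarith

lemma exists_length_emit_le [Finite α] [Finite S] :
    ∃ K, ∀ s a, (A.emit s a).length ≤ K := by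
  obtain ⟨K, hK⟩ := (Set.finite_range fun p : S × α => (A.emit p.1 p.2).length).bddAbove
  exact ⟨K, fun s a => hK ⟨(s, a), rfl⟩⟩

end SeqAut

/-! ### The input tape -/

lemma inputAt_append_cons {α : Type*} (a b : List α) (y : α) :
    inputAt (a ++ y :: b) (a.length + 1) = InSym.letter y := by
  simp [inputAt]

lemma inputAt_length {α : Type*} (w : List α) :
    inputAt w (w.length + 1) = InSym.rightEnd := by
  simp [inputAt]

/-! ### A virtual input head -/

section VirtualHead

variable {α γ S : Type*} (A : SeqAut γ α S) (prev : S → γ → S) (K : ℕ)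

/-- The state of `A` before the scanned square, and the index of the virtual head in the block that
`A` prints there. The recorded data are `s` and `m`: if `m = some j`, they are these two; if
`m = none`, the head came from the right, `s` is the state after the scanned square, and the
virtual head is on the last letter of the block. -/
def resolve (s : S) (m : Option (Fin (K + 1))) : InSym γ → S × ℕ
  | InSym.leftEnd => (s, 0)
  | InSym.rightEnd => (s, 0)
  | InSym.letter y =>
    match m with
    | some j => (s, j)
    | none => (prev s y, (A.emit (prev s y) y).length - 1)

/-- The symbol under the virtual head, at index `j` of the block printed from the state `s`. (The value
for an index outside the block is never used.) -/
def virtualSym (s : S) (j : ℕ) : InSym γ → InSym α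
  | InSym.leftEnd => InSym.leftEnd
  | InSym.rightEnd => InSym.rightEnd
  | InSym.letter y =>
    match (A.emit s y)[j]? with
    | some a => InSym.letter a
    | none => InSym.rightEnd

/-- A move of the virtual head: the new recorded data, and the move of the real head. -/
def headMove (s : S) (j : ℕ) (x : InSym γ) : Move → S × Option (Fin (K + 1)) × Move
  | Move.stay => (s, some (Fin.ofNat (K + 1) j), Move.stay)
  | Move.left =>
    if j = 0 then (s, none, Move.left) else (s, some (Fin.ofNat (K + 1) (j - 1)), Move.stay)
  | Move.right =>
    match x with
    | InSym.leftEnd => (s, some 0, Move.right)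
    | InSym.rightEnd => (s, some 0, Move.right)
    | InSym.letter y =>
      if j + 1 < (A.emit s y).length then (s, some (Fin.ofNat (K + 1) (j + 1)), Move.stay)
      else (A.next s y, some 0, Move.right)

variable (s₀ : S) (w : List γ)

/-- `HeadAt A s₀ w p s j v`: with the real head on square `p` of the tape holding `w`, the state
`s` of `A` and the index `j` describe the square `v` of the tape holding `A.out s₀ w`. -/
inductive HeadAt : ℕ → S → ℕ → ℕ → Prop
  | leftEnd : HeadAt 0 s₀ 0 0
  | letter (a : List γ) (y : γ) (b : List γ) (hw : w = a ++ y :: b) (j : ℕ)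
      (hj : j < (A.emit (A.state s₀ a) y).length) :
      HeadAt (a.length + 1) (A.state s₀ a) j ((A.out s₀ a).length + j + 1)
  | rightEnd : HeadAt (w.length + 1) (A.state s₀ w) 0 ((A.out s₀ w).length + 1)

/-- The same correspondence for recorded data that have not yet been resolved. -/
inductive HeadRel : ℕ → S → Option (Fin (K + 1)) → ℕ → Prop
  | resolved {p : ℕ} {s : S} {j : Fin (K + 1)} {v : ℕ} (h : HeadAt A s₀ w p s j v) :
      HeadRel p s (some j) v
  | leftEnd : HeadRel 0 s₀ none 0
  | fromRight (a : List γ) (y : γ) (b : List γ) (hw : w = a ++ y :: b) :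
      HeadRel (a.length + 1) (A.state s₀ (a ++ [y])) none (A.out s₀ (a ++ [y])).length

variable {A prev K s₀ w}

lemma headAt_of_append (hA : ∀ s y, A.emit s y ≠ []) {a b : List γ} (hw : w = a ++ b) :
    HeadAt A s₀ w (a.length + 1) (A.state s₀ a) 0 ((A.out s₀ a).length + 1) := by
  cases b with
  | nil =>
    obtain rfl : w = a := by simpa using hw
    exact .rightEnd
  | cons y b => exact .letter a y b hw 0 (List.length_pos_iff.2 (hA _ _))

lemma HeadAt.headRel {p : ℕ} {s : S} {j v : ℕ} (h : HeadAt A s₀ w p s j v) (hj : j ≤ K) :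
    HeadRel A K s₀ w p s (some (Fin.ofNat (K + 1) j)) v := by
  refine .resolved ?_
  rwa [Fin.val_ofNat, Nat.mod_eq_of_lt (Nat.lt_succ_of_le hj)]

lemma HeadAt.index_le (hK : ∀ s y, (A.emit s y).length ≤ K) {p : ℕ} {s : S} {j v : ℕ}
    (h : HeadAt A s₀ w p s j v) : j ≤ K := by
  cases h with
  | leftEnd => exact Nat.zero_le _
  | letter a y b hw j hj => exact hj.le.trans (hK _ _)
  | rightEnd => exact Nat.zero_le _

/-- Resolving the data is possible because the automaton is reversible. -/
lemma HeadRel.headAt_resolve (hA : ∀ s y, A.emit s y ≠ [])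
    (hprev : ∀ s y, prev (A.next s y) y = s) {p : ℕ} {s : S} {m : Option (Fin (K + 1))} {v : ℕ}
    (h : HeadRel A K s₀ w p s m v) :
    HeadAt A s₀ w p (resolve A prev K s m (inputAt w p)).1
      (resolve A prev K s m (inputAt w p)).2 v := by
  cases h with
  | leftEnd => exact .leftEnd
  | @resolved _ _ j _ h =>
    generalize hj : (j : ℕ) = i at h
    cases h with
    | leftEnd => exact .leftEnd
    | letter a y b hw _ hi =>
      rw [hw, inputAt_append_cons, ← hw]
      simpa [resolve, hj] using HeadAt.letter a y b hw i hi
    | rightEnd => rw [inputAt_length]; exact .rightEnd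
  | fromRight a y b hw =>
    have hpos := List.length_pos_iff.2 (hA (A.state s₀ a) y)
    have h := HeadAt.letter (A := A) (s₀ := s₀) a y b hw
      ((A.emit (A.state s₀ a) y).length - 1) (by omega)
    rw [show (A.out s₀ a).length + ((A.emit (A.state s₀ a) y).length - 1) + 1 =
      (A.out s₀ (a ++ [y])).length by simp; omega] at h
    rw [hw, inputAt_append_cons, ← hw]
    simpa [resolve, hprev] using h

lemma HeadAt.virtualSym_eq {p : ℕ} {s : S} {j v : ℕ} (h : HeadAt A s₀ w p s j v) :
    virtualSym A s j (inputAt w p) = inputAt (A.out s₀ w) v := by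
  cases h with
  | leftEnd => rfl
  | letter a y b hw j hj =>
    rw [hw, inputAt_append_cons]
    simp [virtualSym, inputAt, List.getElem?_append_right,
      List.getElem?_append_left, hj]
  | rightEnd => rw [inputAt_length, inputAt_length]; rfl

/-- To the left of a block the virtual head enters the block of the previous letter, which is not
scanned yet: only the state after that letter can be recorded. -/
lemma HeadAt.headRel_left {p : ℕ} {s : S} {v : ℕ}
    (h : HeadAt A s₀ w p s 0 v) : HeadRel A K s₀ w (p - 1) s none (v - 1) := by
  have key : ∀ a b : List γ, w = a ++ b →
      HeadRel A K s₀ w a.length (A.state s₀ a) none (A.out s₀ a).length := by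
    intro a b hw
    rcases List.eq_nil_or_concat a with rfl | ⟨a, y, rfl⟩
    · exact .leftEnd
    · have := HeadRel.fromRight (A := A) (K := K) (s₀ := s₀) a y b (by simpa using hw)
      simpa using this
  cases h with
  | leftEnd => exact .leftEnd
  | letter a y b hw _ hj => exact key a _ hw
  | rightEnd => exact key w [] (by simp)

lemma HeadAt.headRel_move (hA : ∀ s y, A.emit s y ≠ []) (hK : ∀ s y, (A.emit s y).length ≤ K)
    {p : ℕ} {s : S} {j v : ℕ} (h : HeadAt A s₀ w p s j v) (μ : Move) :
    HeadRel A K s₀ w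
      (moveInput w.length (headMove A K s j (inputAt w p) μ).2.2 p)
      (headMove A K s j (inputAt w p) μ).1
      (headMove A K s j (inputAt w p) μ).2.1
      (moveInput (A.out s₀ w).length μ v) := by
  have hjK := h.index_le hK
  cases μ with
  | stay => exact h.headRel hjK
  | left =>
    rcases Nat.eq_zero_or_pos j with rfl | hj
    · exact h.headRel_left
    · simp only [headMove, if_neg hj.ne', moveInput]
      cases h with
      | leftEnd => exact absurd hj (lt_irrefl _)
      | rightEnd => exact absurd hj (lt_irrefl _)
      | letter a y b hw _ hj' =>
        have h' := HeadAt.letter (A := A) (s₀ := s₀) a y b hw (j - 1) (by omega)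
        rw [show (A.out s₀ a).length + (j - 1) + 1 = (A.out s₀ a).length + j + 1 - 1 by omega]
          at h'
        exact h'.headRel (by omega)
  | right =>
    cases h with
    | leftEnd =>
      have h' := headAt_of_append (s₀ := s₀) hA (List.nil_append w).symm
      simpa [headMove, inputAt, moveInput] using h'.headRel (Nat.zero_le K)
    | rightEnd =>
      rw [inputAt_length]
      simpa [headMove, moveInput] using
        (HeadAt.rightEnd (A := A) (s₀ := s₀) (w := w)).headRel (Nat.zero_le K)
    | letter a y b hw _ hj =>
      have hlen : (A.out s₀ w).length = (A.out s₀ a).length + (A.emit (A.state s₀ a) y).length +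
          (A.out (A.next (A.state s₀ a) y) b).length := by
        simp [hw, add_assoc]
      have hlen' : w.length = a.length + 1 + b.length := by simp [hw]; omega
      have hsym : inputAt w (a.length + 1) = InSym.letter y := by rw [hw, inputAt_append_cons]
      rw [hsym]
      by_cases hj' : j + 1 < (A.emit (A.state s₀ a) y).length
      · have h' := HeadAt.letter (s₀ := s₀) a y b hw (j + 1) hj'
        simp only [headMove, if_pos hj', moveInput]
        rw [min_eq_left (by omega)]
        exact h'.headRel ((hj'.le).trans (hK _ _))
      · have h' := headAt_of_append (s₀ := s₀) (w := w) (a := a ++ [y]) (b := b) hA (by simp [hw])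
        have h'' := h'.headRel (Nat.zero_le K)
        simp only [headMove, if_neg hj', moveInput]
        rw [min_eq_left (by omega), min_eq_left (by omega)]
        rw [show (A.out s₀ a).length + j + 1 + 1 = (A.out s₀ (a ++ [y])).length + 1 by
          simp; omega]
        simpa using h''

lemma HeadAt.exists_prefix {p : ℕ} {s : S} {j v : ℕ} (h : HeadAt A s₀ w p s j v) :
    ∃ a b, w = a ++ b ∧ s = A.state s₀ a ∧ (p = a.length + 1 ∨ p = 0 ∧ a = []) := by
  cases h with
  | leftEnd => exact ⟨[], w, rfl, rfl, .inr ⟨rfl, rfl⟩⟩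
  | letter a y b hw => exact ⟨a, y :: b, hw, rfl, .inl rfl⟩
  | rightEnd => exact ⟨w, [], by simp, rfl, .inl rfl⟩

end VirtualHead

/-! ### The simulating machine -/

section Simulation

variable {α β γ δ Q Γ S R : Type*}

/-- States of the simulating machine. Those in the first summand simulate a state of the given
machine, with the data of the virtual head and the state of the automaton that rewrites the output;
`some s` in the second summand scans the rest of the input, and `none` is the halting state. -/
abbrev SimState (Q S R : Type*) (K : ℕ) := (Q × S × Option (Fin (K + 1)) × R) ⊕ Option S

/-- The machine that simulates `M` on the word printed by `A`, sends the output through `B`, and,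
when `M` halts, scans the rest of the input in order to find the last state `s` of `A` and to print
`fin s`. -/
def simulator (M : Transducer α β Q Γ) (A : SeqAut γ α S) (prev : S → γ → S) (K : ℕ) (s₀ : S)
    (B : SeqAut β δ R) (r₀ : R) (fin : S → List δ) : Transducer γ δ (SimState Q S R K) Γ where
  start := .inl (M.start, s₀, some 0, r₀)
  blank := M.blank
  trans
    | .inl (q, s, m, r), x, g =>
      match M.trans q
          (virtualSym A (resolve A prev K s m x).1 (resolve A prev K s m x).2 x) g with
      | some a => some
          { next := .inl (a.next,
              (headMove A K (resolve A prev K s m x).1 (resolve A prev K s m x).2 x a.inMove).1,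
              (headMove A K (resolve A prev K s m x).1 (resolve A prev K s m x).2 x a.inMove).2.1,
              B.state r a.emit)
            write := a.write
            inMove :=
              (headMove A K (resolve A prev K s m x).1 (resolve A prev K s m x).2 x a.inMove).2.2
            workMove := a.workMove
            emit := B.out r a.emit }
      | none => some ⟨.inr (some (resolve A prev K s m x).1), g, .stay, .stay, []⟩
    | .inr (some s), .leftEnd, g => some ⟨.inr (some s), g, .right, .stay, []⟩
    | .inr (some s), .letter y, g => some ⟨.inr (some (A.next s y)), g, .right, .stay, []⟩
    | .inr (some s), .rightEnd, g => some ⟨.inr none, g, .stay, .stay, fin s⟩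
    | .inr none, _, _ => none

variable {M : Transducer α β Q Γ} {A : SeqAut γ α S} {prev : S → γ → S} {K : ℕ} {s₀ : S}
  {B : SeqAut β δ R} {r₀ : R} {fin : S → List δ} {w : List γ}

variable (A K s₀ B r₀ w) in
/-- The configuration `C'` of the simulator represents the configuration `C` of the machine. -/
def Represents (C : Cfg β Q Γ) (C' : Cfg δ (SimState Q S R K) Γ) : Prop :=
  ∃ p s m, HeadRel A K s₀ w p s m C.inPos ∧
    C' = ⟨.inl (C.state, s, m, B.state r₀ C.out), p, C.work, C.workPos, B.out r₀ C.out⟩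

variable (Q R A K s₀ w) in
/-- In the configuration `C'` the simulator is scanning the rest of the input, with its work head
on square `k` and with output `o`. -/
def Scanning (k : ℕ) (o : List δ) (C' : Cfg δ (SimState Q S R K) Γ) : Prop :=
  ∃ a b, w = a ++ b ∧ C'.state = .inr (some (A.state s₀ a)) ∧
    (C'.inPos = a.length + 1 ∨ C'.inPos = 0 ∧ a = []) ∧ C'.workPos = k ∧ C'.out = o

lemma represents_init (hA : ∀ s y, A.emit s y ≠ []) :
    Represents A K s₀ B r₀ w M.init (simulator M A prev K s₀ B r₀ fin).init := by
  refine ⟨1, s₀, some 0, ?_, rfl⟩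
  have h := headAt_of_append (s₀ := s₀) hA (List.nil_append w).symm
  exact h.headRel (Nat.zero_le K)

lemma Represents.step_some (hA : ∀ s y, A.emit s y ≠ [])
    (hK : ∀ s y, (A.emit s y).length ≤ K) (hprev : ∀ s y, prev (A.next s y) y = s)
    {C D : Cfg β Q Γ} {C' : Cfg δ (SimState Q S R K) Γ} (h : Represents A K s₀ B r₀ w C C')
    (hD : M.step (A.out s₀ w) C = some D) :
    ∃ D', (simulator M A prev K s₀ B r₀ fin).step w C' = some D' ∧
      Represents A K s₀ B r₀ w D D' := by
  obtain ⟨p, s, m, hh, rfl⟩ := h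
  have hr := hh.headAt_resolve (prev := prev) hA hprev
  obtain ⟨a, ha, rfl⟩ := Option.map_eq_some_iff.1 hD
  rw [← hr.virtualSym_eq] at ha
  refine ⟨_, ?_, _, _, _, hr.headRel_move hA hK a.inMove, rfl⟩
  simp [Transducer.step, simulator, ha, Transducer.perform]

lemma Represents.step_none (hA : ∀ s y, A.emit s y ≠ [])
    (hprev : ∀ s y, prev (A.next s y) y = s)
    {C : Cfg β Q Γ} {C' : Cfg δ (SimState Q S R K) Γ} (h : Represents A K s₀ B r₀ w C C')
    (hD : M.step (A.out s₀ w) C = none) :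
    ∃ D', (simulator M A prev K s₀ B r₀ fin).step w C' = some D' ∧
      Scanning Q R A K s₀ w C.workPos (B.out r₀ C.out) D' := by
  obtain ⟨p, s, m, hh, rfl⟩ := h
  have hr := hh.headAt_resolve (prev := prev) hA hprev
  have ha := Option.map_eq_none_iff.1 hD
  rw [← hr.virtualSym_eq] at ha
  obtain ⟨a, b, hw, hs, hp⟩ := hr.exists_prefix
  refine ⟨_, by simp only [Transducer.step, simulator, ha, Option.map_some]; rfl,
    a, b, hw, ?_, hp, rfl, by simp [Transducer.perform]⟩
  simp [Transducer.perform, hs]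

lemma Scanning.step {k : ℕ} {o : List δ} {C' : Cfg δ (SimState Q S R K) Γ}
    (h : Scanning Q R A K s₀ w k o C') :
    ∃ D', (simulator M A prev K s₀ B r₀ fin).step w C' = some D' ∧
      (Scanning Q R A K s₀ w k o D' ∧ C'.inPos < D'.inPos ∧ D'.inPos ≤ w.length + 1 ∨
        D'.state = .inr none ∧ D'.workPos = k ∧ D'.out = o ++ fin (A.state s₀ w)) := by
  obtain ⟨a, b, hw, hs, hp, hk, ho⟩ := h
  rcases hp with hp | ⟨hp, rfl⟩
  · cases b with
    | nil =>
      obtain rfl : w = a := by simpa using hw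
      refine ⟨Transducer.perform w.length C'
          ⟨.inr none, C'.work C'.workPos, .stay, .stay, fin (A.state s₀ w)⟩,
        by simp only [Transducer.step, hs, hp, inputAt_length, simulator, Option.map_some],
        .inr ⟨rfl, hk, ?_⟩⟩
      simp [Transducer.perform, ho]
    | cons y b =>
      have hsym : inputAt w C'.inPos = InSym.letter y := by rw [hp, hw, inputAt_append_cons]
      refine ⟨Transducer.perform w.length C'
          ⟨.inr (some (A.next (A.state s₀ a) y)), C'.work C'.workPos, .right, .stay, []⟩,
        by simp only [Transducer.step, hs, hsym, simulator, Option.map_some],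
        .inl ⟨⟨a ++ [y], b, by simp [hw], ?_, .inl ?_, hk, ?_⟩, ?_, ?_⟩⟩
      all_goals simp [Transducer.perform, moveInput, ho, hp, hw]
  · have hsym : inputAt w C'.inPos = InSym.leftEnd := by rw [hp]; rfl
    refine ⟨Transducer.perform w.length C'
        ⟨.inr (some (A.state s₀ [])), C'.work C'.workPos, .right, .stay, []⟩,
      by simp only [Transducer.step, hs, hsym, simulator, Option.map_some],
      .inl ⟨⟨[], w, rfl, ?_, .inl ?_, hk, ?_⟩, ?_, ?_⟩⟩
    all_goals simp [Transducer.perform, moveInput, ho, hp]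

lemma simulator_step_of_state_none {C' : Cfg δ (SimState Q S R K) Γ}
    (h : C'.state = .inr none) : (simulator M A prev K s₀ B r₀ fin).step w C' = none := by
  simp [Transducer.step, simulator, h]

lemma Scanning.reaches_halt {k : ℕ} {o : List δ} {C' : Cfg δ (SimState Q S R K) Γ}
    (h : Scanning Q R A K s₀ w k o C') :
    ∃ D', StateTransition.Reaches ((simulator M A prev K s₀ B r₀ fin).step w) C' D' ∧
      D'.state = .inr none ∧ D'.out = o ++ fin (A.state s₀ w) := by
  induction hd : w.length + 1 - C'.inPos using Nat.strong_induction_on generalizing C' with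
  | _ d ih =>
    obtain ⟨D', hstep, ⟨hD', hlt, hle⟩ | ⟨hD', -, ho⟩⟩ :=
      h.step (M := M) (prev := prev) (B := B) (r₀ := r₀) (fin := fin)
    · obtain ⟨E', hr, hE⟩ := ih (w.length + 1 - D'.inPos) (by omega) hD' rfl
      exact ⟨E', .head hstep hr, hE⟩
    · exact ⟨D', .single hstep, hD', ho⟩

lemma simulator_reaches (hA : ∀ s y, A.emit s y ≠ [])
    (hK : ∀ s y, (A.emit s y).length ≤ K) (hprev : ∀ s y, prev (A.next s y) y = s)
    {C : Cfg β Q Γ} (h : StateTransition.Reaches (M.step (A.out s₀ w)) M.init C) :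
    ∃ C', StateTransition.Reaches ((simulator M A prev K s₀ B r₀ fin).step w)
        (simulator M A prev K s₀ B r₀ fin).init C' ∧ Represents A K s₀ B r₀ w C C' := by
  induction h with
  | refl => exact ⟨_, .refl, represents_init hA⟩
  | tail _ hstep ih =>
    obtain ⟨C', hr, hC'⟩ := ih
    obtain ⟨D', hD, hD'⟩ := hC'.step_some (fin := fin) hA hK hprev hstep
    exact ⟨D', hr.tail hD, hD'⟩

lemma simulator_outputs (hA : ∀ s y, A.emit s y ≠ [])
    (hK : ∀ s y, (A.emit s y).length ≤ K) (hprev : ∀ s y, prev (A.next s y) y = s)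
    {v : List β} (h : M.Outputs (A.out s₀ w) v) :
    (simulator M A prev K s₀ B r₀ fin).Outputs w (B.out r₀ v ++ fin (A.state s₀ w)) := by
  obtain ⟨C, hC, hhalt, rfl⟩ := h
  obtain ⟨C', hr, hC'⟩ := simulator_reaches (B := B) (r₀ := r₀) (fin := fin) hA hK hprev hC
  obtain ⟨D', hD, hD'⟩ := hC'.step_none (fin := fin) hA hprev hhalt
  obtain ⟨E', hE, hstate, hout⟩ :=
    hD'.reaches_halt (M := M) (prev := prev) (B := B) (r₀ := r₀) (fin := fin)
  exact ⟨E', (hr.tail hD).trans hE, simulator_step_of_state_none hstate, hout⟩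

lemma simulator_runsInSpace (hA : ∀ s y, A.emit s y ≠ [])
    (hK : ∀ s y, (A.emit s y).length ≤ K) (hprev : ∀ s y, prev (A.next s y) y = s)
    {t : ℕ} (h : M.RunsInSpace (A.out s₀ w) t) :
    (simulator M A prev K s₀ B r₀ fin).RunsInSpace w t := by
  intro C' hC'
  suffices H : ∃ C, StateTransition.Reaches (M.step (A.out s₀ w)) M.init C ∧
      (Represents A K s₀ B r₀ w C C' ∨ (∃ o, Scanning Q R A K s₀ w C.workPos o C') ∨
        C'.state = .inr none ∧ C'.workPos = C.workPos) by
    obtain ⟨C, hC, ⟨p, s, m, -, rfl⟩ | ⟨o, a, b, -, -, -, hk, -⟩ | ⟨-, hk⟩⟩ := H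
    · exact h C hC
    · exact hk ▸ h C hC
    · exact hk ▸ h C hC
  induction hC' with
  | refl => exact ⟨_, .refl, .inl (represents_init hA)⟩
  | @tail C' D' _ hstep ih =>
    rw [Option.mem_def] at hstep
    obtain ⟨C, hC, hrep | ⟨o, hscan⟩ | ⟨hhalt, -⟩⟩ := ih
    · cases hM : M.step (A.out s₀ w) C with
      | some D =>
        obtain ⟨E', hE, hE'⟩ := hrep.step_some (fin := fin) hA hK hprev hM
        obtain rfl := Option.some.inj (hE.symm.trans hstep)
        exact ⟨D, hC.tail hM, .inl hE'⟩
      | none =>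
        obtain ⟨E', hE, hE'⟩ := hrep.step_none (fin := fin) hA hprev hM
        obtain rfl := Option.some.inj (hE.symm.trans hstep)
        exact ⟨C, hC, .inr (.inl ⟨_, hE'⟩)⟩
    · obtain ⟨E', hE, hE'⟩ :=
        hscan.step (M := M) (prev := prev) (B := B) (r₀ := r₀) (fin := fin)
      obtain rfl := Option.some.inj (hE.symm.trans hstep)
      obtain ⟨hE', -⟩ | ⟨hE', hk, -⟩ := hE'
      · exact ⟨C, hC, .inr (.inl ⟨_, hE'⟩)⟩
      · exact ⟨C, hC, .inr (.inr ⟨hE', hk⟩)⟩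
    · rw [simulator_step_of_state_none hhalt] at hstep
      cases hstep

end Simulation

/-! ### Closure properties of logspace computable functions -/

lemma Transducer.RunsInSpace.mono {α β Q Γ : Type*} {M : Transducer α β Q Γ} {w : List α}
    {s t : ℕ} (h : M.RunsInSpace w s) (hst : s ≤ t) : M.RunsInSpace w t :=
  fun C hC => (h C hC).trans_le hst

/-- Over a logarithmic space bound, a linear growth of the length costs only a constant factor. -/
lemma log_add_one_le_of_le_mul {K l n : ℕ} (h : l ≤ K * n) :
    Nat.log 2 l + 1 ≤ (Nat.log 2 K + 2) * (Nat.log 2 n + 1) := by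
  have hlog : Nat.log 2 l ≤ Nat.log 2 K + Nat.log 2 n + 1 := by
    refine Nat.lt_succ_iff.1 (Nat.log_lt_of_lt_pow' (by omega) (h.trans_lt ?_))
    calc K * n < 2 ^ (Nat.log 2 K + 1) * 2 ^ (Nat.log 2 n + 1) :=
          Nat.mul_lt_mul'' (Nat.lt_pow_succ_log_self one_lt_two K)
            (Nat.lt_pow_succ_log_self one_lt_two n)
      _ = 2 ^ (Nat.log 2 K + Nat.log 2 n + 1 + 1) := by ring
  nlinarith [Nat.zero_le (Nat.log 2 K * Nat.log 2 n)]

/-- Logspace computable functions are stable under precomposition with a reversible sequential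
automaton, postcomposition with a sequential automaton, and appending a word that depends on the
last state of the former. -/
theorem LogspaceComputable.comp_seqAut {α β γ δ : Type*} {S R : Type} [Finite α] [Finite β]
    [Finite γ] [Finite δ] [Finite S] [Finite R] {f : List α → List β} (hf : LogspaceComputable f)
    (A : SeqAut γ α S) (hA : ∀ s y, A.emit s y ≠ []) (prev : S → γ → S)
    (hprev : ∀ s y, prev (A.next s y) y = s) (s₀ : S) (B : SeqAut β δ R) (r₀ : R)
    (fin : S → List δ) :
    LogspaceComputable fun w => B.out r₀ (f (A.out s₀ w)) ++ fin (A.state s₀ w) := by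
  obtain ⟨Q, Γ, _, _, M, c, hM⟩ := hf
  obtain ⟨K, hK⟩ := A.exists_length_emit_le
  refine ⟨SimState Q S R K, Γ, inferInstance, inferInstance, simulator M A prev K s₀ B r₀ fin,
    c * (Nat.log 2 K + 2), fun w => ⟨simulator_outputs hA hK hprev (hM _).1, ?_⟩⟩
  refine (simulator_runsInSpace hA hK hprev (hM _).2).mono ?_
  rw [mul_assoc]
  exact Nat.mul_le_mul_left c (log_add_one_le_of_le_mul (A.length_out_le hK s₀ w))

lemma logspaceComputable_const_nil {α β : Type*} [Finite α] [Finite β] :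
    LogspaceComputable fun _ : List α => ([] : List β) := by
  let M : Transducer α β Unit Unit := ⟨(), (), fun _ _ _ => none⟩
  have hM (w : List α) (C) : M.step w C = none := rfl
  refine ⟨Unit, Unit, inferInstance, inferInstance, M, 1,
    fun w => ⟨⟨M.init, .refl, hM _ _, rfl⟩, fun C hC => ?_⟩⟩
  rcases hC.cases_head with rfl | ⟨D, hD, -⟩
  · exact Nat.mul_pos one_pos (Nat.succ_pos _)
  · cases hD

/-! ### Words and normal forms -/

section Groups

variable {G : Type*} [Group G]

lemma IsSymmGenSet.exists_wordValue_eq {X : Finset G} (hX : IsSymmGenSet X) (g : G) :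
    ∃ u, wordValue X u = g := by
  have hg : g ∈ Subgroup.closure (X : Set G) := hX.2 ▸ Subgroup.mem_top g
  rw [← Subgroup.mem_toSubmonoid, Subgroup.closure_toSubmonoid] at hg
  obtain ⟨l, hl, rfl⟩ := Submonoid.exists_list_of_mem_closure hg
  have hl' : ∀ x ∈ l, x ∈ X := fun x hx =>
    (hl x hx).elim id fun h => inv_inv x ▸ hX.1 _ h
  refine ⟨l.pmap (fun x h => ⟨x, h⟩) hl', ?_⟩
  simp [wordValue, List.map_pmap]

/-- A pair has a logspace normal form if and only if some logspace computable function chooses, for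
each element, one of the words that represent it; the normal form is then the range. -/
lemma pairHasLogspaceNormalForm_iff {X : Finset G} (hX : IsSymmGenSet X) :
    PairHasLogspaceNormalForm X ↔ ∃ f : List X → List X, LogspaceComputable f ∧
      (∀ w, wordValue X (f w) = wordValue X w) ∧
      ∀ w w', wordValue X w = wordValue X w' → f w = f w' := by
  constructor
  · rintro ⟨f, hf, L, hL, h⟩
    refine ⟨f, hf, fun w => (h w).2, fun w w' hw => hL.injOn (h w).1 (h w').1 ?_⟩
    rw [(h w).2, (h w').2, hw]
  · rintro ⟨f, hf, hval, hcan⟩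
    refine ⟨f, hf, Set.range f, ⟨fun _ _ => Set.mem_univ _, ?_, ?_⟩,
      fun w => ⟨⟨w, rfl⟩, hval w⟩⟩
    · rintro _ ⟨w, rfl⟩ _ ⟨w', rfl⟩ h
      exact hcan _ _ (by rw [← hval w, h, hval w'])
    · intro g _
      obtain ⟨w, rfl⟩ := hX.exists_wordValue_eq g
      exact ⟨f w, ⟨w, rfl⟩, hval w⟩

/-- A normal form function can be given an input alphabet over which each element is represented by
a nonempty word. Only the empty generating set of the trivial group needs a new alphabet. -/
lemma PairHasLogspaceNormalForm.exists_nonempty_words {G : Type u} [Group G] {X : Finset G}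
    (hX : IsSymmGenSet X) (h : PairHasLogspaceNormalForm X) :
    ∃ (α : Type u) (_ : Finite α) (ev : α → G) (f : List α → List X), LogspaceComputable f ∧
      (∀ w, wordValue X (f w) = (w.map ev).prod) ∧
      (∀ w w', (w.map ev).prod = (w'.map ev).prod → f w = f w') ∧
      ∀ g, ∃ u ≠ [], (u.map ev).prod = g := by
  obtain ⟨f, hf, hval, hcan⟩ := (pairHasLogspaceNormalForm_iff hX).1 h
  rcases X.eq_empty_or_nonempty with rfl | ⟨x, hx⟩
  · have htriv (g : G) : g = 1 := by
      have hg : g ∈ Subgroup.closure ((∅ : Finset G) : Set G) := hX.2 ▸ Subgroup.mem_top g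
      simpa using hg
    exact ⟨PUnit, inferInstance, fun _ => 1, fun _ => [], logspaceComputable_const_nil,
      fun w => (htriv _).trans (htriv _).symm, fun _ _ _ => rfl,
      fun g => ⟨[PUnit.unit], by simp, (htriv _).trans (htriv _).symm⟩⟩
  · refine ⟨X, inferInstance, Subtype.val, f, hf, hval, hcan, fun g => ?_⟩
    obtain ⟨u, hu⟩ := hX.exists_wordValue_eq (x⁻¹ * g)
    refine ⟨⟨x, hx⟩ :: u, by simp, ?_⟩
    change x * wordValue X u = g
    rw [hu, mul_inv_cancel_left]

/-- A transversal of the right cosets of a subgroup of finite index, with states `c : Fin n` for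
the cosets, representatives `t c`, and the action of the group on the cosets. -/
lemma exists_transversal (K : Subgroup G) [K.FiniteIndex] :
    ∃ (n : ℕ) (c₀ : Fin n) (t : Fin n → G) (act : Fin n → G → Fin n), t c₀ = 1 ∧
      (∀ c g h, act c (g * h) = act (act c g) h) ∧ (∀ c, act c 1 = c) ∧
      (∀ c g, t c * g * (t (act c g))⁻¹ ∈ K) ∧ ∀ g ∈ K, act c₀ g = c₀ := by
  classical
  obtain ⟨n, ⟨e⟩⟩ := Finite.exists_equiv_fin (G ⧸ K)
  -- The right coset of `g` is encoded as the left coset of `g⁻¹`.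
  let t : G ⧸ K → G := Function.update (fun c => c.out⁻¹) ((1 : G) : G ⧸ K) 1
  have ht (c : G ⧸ K) : (((t c)⁻¹ : G) : G ⧸ K) = c := by
    by_cases hc : c = ((1 : G) : G ⧸ K)
    · subst hc; simp [t]
    · simp [t, Function.update_of_ne hc]
  refine ⟨n, e ((1 : G) : G ⧸ K), fun i => t (e.symm i), fun i g => e (g⁻¹ • e.symm i),
    by simp [t], fun i g h => by simp [mul_smul], fun i => by simp, fun i g => ?_, fun g hg => ?_⟩
  · have h : (((t (e.symm i) * g)⁻¹ : G) : G ⧸ K) = (((t (g⁻¹ • e.symm i))⁻¹ : G) : G ⧸ K) := by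
      rw [ht, mul_inv_rev, ← smul_eq_mul, ← MulAction.Quotient.smul_coe, ht]
    simpa using QuotientGroup.eq.1 h
  · have h : ((g⁻¹ : G) : G ⧸ K) = ((1 : G) : G ⧸ K) := QuotientGroup.eq.2 (by simpa using hg)
    simpa [MulAction.Quotient.smul_mk] using h

/-- If a sequential automaton replaces a letter `y`, read in the state `s`, by a word that represents
`t s * y * (t s')⁻¹`, where `s'` is the next state, then the same holds for words. -/
lemma SeqAut.prod_out {γ α S : Type*} {A : SeqAut γ α S} {val : γ → G} {ev : α → G} {t : S → G}
    (h : ∀ s y, ((A.emit s y).map ev).prod = t s * val y * (t (A.next s y))⁻¹) (s : S)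
    (w : List γ) :
    ((A.out s w).map ev).prod = t s * (w.map val).prod * (t (A.state s w))⁻¹ := by
  induction w generalizing s with
  | nil => simp
  | cons y w ih => simp [h, ih, mul_assoc]

/-- An automaton whose letters move the state by a right action reads a word by acting with the
element that the word represents. -/
lemma SeqAut.state_eq_act {γ α S : Type*} {A : SeqAut γ α S} {val : γ → G} {act : S → G → S}
    (hact : ∀ c g h, act c (g * h) = act (act c g) h) (hone : ∀ c, act c 1 = c)
    (h : ∀ s y, A.next s y = act s (val y)) (s : S) (w : List γ) :
    A.state s w = act s (w.map val).prod := by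
  induction w generalizing s with
  | nil => simp [hone]
  | cons y w ih => simp [h, ih, hact]

lemma coe_wordValue {K : Subgroup G} (X : Finset K) (w : List X) :
    ((wordValue X w : K) : G) = (w.map fun x => (x.1 : G)).prod := by
  simp [wordValue, Function.comp_def]

/-! ### Passing to and from a subgroup of finite index -/

lemma PairHasLogspaceNormalForm.subgroup {H : Type*} [Group H] {G : Subgroup H} [G.FiniteIndex]
    {Y : Finset H} {X : Finset G} (hY : IsSymmGenSet Y) (hX : IsSymmGenSet X)
    (h : PairHasLogspaceNormalForm Y) : PairHasLogspaceNormalForm X := by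
  obtain ⟨α, _, ev, f, hf, hval, hcan, hword⟩ := h.exists_nonempty_words hY
  choose W hW₀ hW using hword
  choose V hV using hX.exists_wordValue_eq
  obtain ⟨n, c₀, t, act, ht₀, hact, hone, hmem, hstab⟩ := exists_transversal G
  -- Words over `X` are translated into `H`, brought into normal form, and rewritten over `X`.
  let A : SeqAut X α Unit := ⟨fun _ _ => (), fun _ x => W (x.1 : H)⟩
  let B : SeqAut Y X (Fin n) := ⟨fun c y => act c y, fun c y => V ⟨_, hmem c y⟩⟩
  have hAval (w : List X) : ((A.out () w).map ev).prod = ((wordValue X w : G) : H) := by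
    have := SeqAut.prod_out (A := A) (val := fun x => (x.1 : H)) (ev := ev) (t := fun _ => 1)
      (fun _ x => by simp [A, hW]) () w
    simpa [coe_wordValue] using this
  have hBval (v : List Y) (hv : wordValue Y v ∈ G) :
      ((wordValue X (B.out c₀ v) : G) : H) = wordValue Y v := by
    have hstate : B.state c₀ v = c₀ :=
      (SeqAut.state_eq_act (A := B) hact hone (fun _ _ => rfl) c₀ v).trans (hstab _ hv)
    have := SeqAut.prod_out (A := B) (val := Subtype.val) (ev := fun x => (x.1 : H)) (t := t)
      (fun c y => by rw [← coe_wordValue]; simp [B, hV]) c₀ v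
    rw [coe_wordValue, this, hstate, ht₀]
    simp [wordValue]
  refine (pairHasLogspaceNormalForm_iff hX).2 ⟨_, hf.comp_seqAut A (fun _ _ => hW₀ _)
    (fun _ _ => ()) (fun _ _ => rfl) () B c₀ fun _ => [], fun w => ?_, fun w w' hw => ?_⟩
  · have hfw : wordValue Y (f (A.out () w)) = ((wordValue X w : G) : H) := (hval _).trans (hAval w)
    rw [List.append_nil]
    exact Subtype.ext ((hBval _ (hfw ▸ (wordValue X w).2)).trans hfw)
  · rw [hcan _ (A.out () w') (by rw [hAval, hAval, hw])]

lemma PairHasLogspaceNormalForm.of_subgroup {H : Type*} [Group H] {G : Subgroup H}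
    [G.FiniteIndex] {Y : Finset H} {X : Finset G} (hY : IsSymmGenSet Y) (hX : IsSymmGenSet X)
    (h : PairHasLogspaceNormalForm X) : PairHasLogspaceNormalForm Y := by
  obtain ⟨α, _, ev, f, hf, hval, hcan, hword⟩ := h.exists_nonempty_words hX
  choose W hW₀ hW using hword
  choose V hV using hY.exists_wordValue_eq
  obtain ⟨n, c₀, t, act, ht₀, hact, hone, hmem, -⟩ := exists_transversal G
  -- A word `w` is written as `g * t c` with `g` in `G`, and `g` is brought into normal form.
  let A : SeqAut Y α (Fin n) := ⟨fun c y => act c y, fun c y => W ⟨_, hmem c y⟩⟩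
  let B : SeqAut X Y Unit := ⟨fun _ _ => (), fun _ x => V (x.1 : H)⟩
  have hAstate (w : List Y) : A.state c₀ w = act c₀ (wordValue Y w) :=
    SeqAut.state_eq_act (A := A) hact hone (fun _ _ => rfl) c₀ w
  have hAval (w : List Y) : ((((A.out c₀ w).map ev).prod : G) : H) =
      wordValue Y w * (t (A.state c₀ w))⁻¹ := by
    have := SeqAut.prod_out (A := A) (val := Subtype.val) (ev := fun a => (ev a : H)) (t := t)
      (fun c y => by
        have := congrArg Subtype.val (hW ⟨_, hmem c y⟩)
        simpa [A, Function.comp_def] using this) c₀ w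
    simpa [ht₀, wordValue, Function.comp_def] using this
  have hBval (v : List X) : wordValue Y (B.out () v) = ((wordValue X v : G) : H) := by
    have := SeqAut.prod_out (A := B) (val := fun x => (x.1 : H)) (ev := Subtype.val)
      (t := fun _ => 1) (fun _ x => (hV _).trans (by simp)) () v
    rw [coe_wordValue]
    exact this.trans (by simp)
  refine (pairHasLogspaceNormalForm_iff hY).2 ⟨_, hf.comp_seqAut A (fun _ _ => hW₀ _)
    (fun c y => act c (y : H)⁻¹) (fun c y => ?_) c₀ B () fun c => V (t c), fun w => ?_,
    fun w w' hw => ?_⟩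
  · simp [A, ← hact, hone]
  · have happ (u v : List Y) : wordValue Y (u ++ v) = wordValue Y u * wordValue Y v := by
      simp [wordValue]
    rw [happ, hBval, hval, hAval, hV, inv_mul_cancel_right]
  · have hst : A.state c₀ w = A.state c₀ w' := by rw [hAstate, hAstate, hw]
    have hG : ((A.out c₀ w).map ev).prod = ((A.out c₀ w').map ev).prod :=
      Subtype.ext (by rw [hAval, hAval, hw, hst])
    rw [hcan _ _ hG, hst]

lemma exists_isSymmGenSet (G : Type*) [Group G] [Group.FG G] :
    ∃ X : Finset G, IsSymmGenSet X := by
  classical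
  obtain ⟨S, hS⟩ := Group.FG.out (G := G)
  refine ⟨S ∪ S.image (·⁻¹), fun x hx => ?_,
    top_unique (hS.symm.le.trans (Subgroup.closure_mono ?_))⟩
  · rcases Finset.mem_union.1 hx with hx | hx
    · exact Finset.mem_union_right _ (Finset.mem_image_of_mem _ hx)
    · obtain ⟨y, hy, rfl⟩ := Finset.mem_image.1 hx
      exact Finset.mem_union_left _ (by simpa using hy)
  · exact Finset.coe_subset.2 Finset.subset_union_left

end Groups

end LogspaceNF

theorem mainTheorem2 {H : Type*} [Group H] (hH : Group.FG H) (G : Subgroup H)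
    (hG : G.FiniteIndex) :
    (LogspaceNF.HasLogspaceNormalForm H ↔ LogspaceNF.HasLogspaceNormalForm G) ∧
    (∀ (Y : Finset H) (X : Finset G), LogspaceNF.IsSymmGenSet Y → LogspaceNF.IsSymmGenSet X →
      (LogspaceNF.PairHasLogspaceNormalForm Y ↔ LogspaceNF.PairHasLogspaceNormalForm X)) := by
  have hFG : Group.FG G := inferInstance
  obtain ⟨Y₀, hY₀⟩ := LogspaceNF.exists_isSymmGenSet H
  obtain ⟨X₀, hX₀⟩ := LogspaceNF.exists_isSymmGenSet G
  exact ⟨⟨fun ⟨Y, hY, h⟩ => ⟨X₀, hX₀, h.subgroup hY hX₀⟩,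
      fun ⟨X, hX, h⟩ => ⟨Y₀, hY₀, h.of_subgroup hY₀ hX⟩⟩,
    fun Y X hY hX => ⟨fun h => h.subgroup hY hX, fun h => h.of_subgroup hY hX⟩⟩
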